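/- Let $d\ge 0$ and let $\langle\cdot,\cdot\rangle$, $\|\cdot\|$ be the Euclidean inner product and norm of $\mathbb R^d$, the former extended bilinearly to $\mathbb C^d$. Let $R\subset\mathbb R^d\setminus\{0\}$ be a root system, i.e. a finite set with $\sigma_\alpha(R)=R$ for all $\alpha\in R$, where $\sigma_\alpha(x)=x-2\langle x,\alpha\rangle\alpha/\|\alpha\|^2$. Let $G$ be the group generated by the reflections $\sigma_\alpha$, $\alpha\in R$, and let $R_+=\{\alpha\in R:\langle\alpha,\beta\rangle>0\}$, where $\beta\in\mathbb R^d$ satisfies $\langle\alpha,\beta\rangle\ne0$ for all $\alpha\in R$. Let $k:R\to\mathbb C$ be $G$-invariant, and let $$T_\xi p(x)=\partial_\xi p(x)+\sum_{\alpha\in R_+}k(\alpha)\langle\alpha,\xi\rangle\,\frac{p(x)-p(\sigma_\alpha x)}{\langle\alpha,x\rangle}\qquad(\xi\in\mathbb R^d)$$ be the Dunkl operators on the algebra $\mathcal P=\mathbb C[\mathbb R^d]$ of complex polynomials (whose elements are also evaluated at points of $\mathbb C^d$). Let $\mathcal P_n\subset\mathcal P$ be the space of homogeneous polynomials of degree $n$.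 Assume that $k\in M^*$, i.e. that for every $n\ge1$ the operator $$W_n p=\Big(n+\sum_{\alpha\in R_+}k(\alpha)\Big)p-\sum_{\alpha\in R_+}k(\alpha)\,p\circ\sigma_\alpha$$ is invertible on $\mathcal P_n$. Let $V_k$ be the intertwining operator, that is, the unique linear isomorphism of $\mathcal P$ with $V_k(\mathcal P_n)\subset\mathcal P_n$ for all $n$, $V_k(1)=1$ and $T_\xi V_k=V_k\partial_\xi$ for all $\xi\in\mathbb R^d$. Put $E_n(x,y)=\frac1{n!}V_k(\langle\cdot,y\rangle^n)(x)$, $e^{-\Delta/2}=\sum_{m\ge0}\frac{(-1/2)^m}{m!}\Delta^m$ on $\mathcal P$ (with $\Delta$ the Laplacian), and, for $x\in\mathbb C^d$ and $y\in\mathbb R^d$, $$L_k(x,y)=\sum_{n=0}^\infty\big(e^{-\Delta/2}E_n(x,\cdot)\big)(y).$$ For $\nu\in\mathbb N^d$ let $\varphi_\nu(X)=(\nu!)^{-1/2}X^\nu$, and let $H_\nu=e^{-\Delta/2}\varphi_\nu$ be the normalized Hermite polynomial. Let $c_0=(2\pi)^{d/2}$ and $d\gamma(z)=c_0^{-1}e^{-\|z\|^2/2}\,dz$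 on $\mathbb R^d$. Then, for every $x\in\mathbb C^d$, $$L_k(x,\cdot)=\sum_{\nu\in\mathbb N^d}V_k(\varphi_\nu)(x)\,H_\nu ,$$ where the (unordered) sum converges to $L_k(x,\cdot)$ pointwise on $\mathbb R^d$ and in $L^2(\mathbb R^d,d\gamma)$. Moreover $e^{-\|\cdot\|^2/4}L_k(x,\cdot)\in L^2(\mathbb R^d)$ (Lebesgue measure), $\sum_\nu|V_k(\varphi_\nu)(x)|^2<\infty$, and $$\big\|e^{-\|\cdot\|^2/4}L_k(x,\cdot)\big\|_{L^2(\mathbb R^d)}^2=c_0\sum_{\nu\in\mathbb N^d}|V_k(\varphi_\nu)(x)|^2 .$$ -/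

import Mathlib

open MvPolynomial MeasureTheory

noncomputable section

namespace Dunkl

/-- The Euclidean space `ℝ^d`. -/
abbrev E (d : ℕ) : Type := EuclideanSpace ℝ (Fin d)

/-- The algebra `𝒫` of complex polynomials on `ℝ^d`; such a polynomial can be evaluated at
points of `ℂ^d` as well. -/
abbrev Poly (d : ℕ) : Type := MvPolynomial (Fin d) ℂ

variable {d : ℕ}

/-- The inclusion of `ℝ^d` into `ℂ^d`. -/
def toComplex (y : E d) : Fin d → ℂ := fun i => (y i : ℂ)

/-! ### Reflections, root systems and the reflection group -/

/-- The orthogonal reflection `σ_α` in the hyperplane orthogonal to `α`. -/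
def refl (α : E d) : E d ≃ₗᵢ[ℝ] E d := (ℝ ∙ α)ᗮ.reflection

theorem refl_apply (α x : E d) :
    refl α x = x - (2 * inner ℝ x α / ‖α‖ ^ 2) • α := by
  have h := Submodule.reflection_orthogonalComplement_singleton_eq_neg (𝕜 := ℝ) α
  rw [refl, Submodule.reflection_orthogonal_apply, Submodule.reflection_singleton_apply,
    real_inner_comm]
  simp only [RCLike.ofReal_real_eq_id, id_eq, neg_sub, two_smul]
  rw [mul_div_assoc, two_mul, add_smul]

/-- A (finite) root system in `ℝ^d`: a finite set of nonzero vectors, stable under the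
reflections in its members.  It need not span, need not be crystallographic and need not be
reduced. -/
structure IsRootSystem (R : Finset (E d)) : Prop where
  zero_notMem : (0 : E d) ∉ R
  refl_mem : ∀ α ∈ R, ∀ β ∈ R, refl α β ∈ R

/-- The group `G` generated by the reflections `σ_α`, `α ∈ R`. -/
def reflectionGroup (R : Finset (E d)) : Subgroup (E d ≃ₗᵢ[ℝ] E d) :=
  Subgroup.closure {s | ∃ α ∈ R, s = refl α}

/-- `k` is a parameter function: it is `G`-invariant on `R` (its values off `R` play no role). -/
def IsParameter (R : Finset (E d)) (k : E d → ℂ) : Prop :=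
  ∀ g ∈ reflectionGroup R, ∀ α ∈ R, k (g α) = k α

open Classical in
/-- The positive roots `R_+ = {α ∈ R : ⟨α, β⟩ > 0}`. -/
def posRoots (R : Finset (E d)) (β : E d) : Finset (E d) :=
  R.filter fun α => 0 < inner ℝ α β

/-! ### Dunkl operators on polynomials -/

/-- The linear form `x ↦ ⟨α, x⟩`, as a polynomial. -/
def linForm (α : E d) : Poly d := ∑ j, C (α j : ℂ) * X j

/-- The action `(L_g p)(x) = p(g x)` on polynomials. -/
def act (g : E d ≃ₗᵢ[ℝ] E d) : Poly d →ₐ[ℂ] Poly d :=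
  aeval fun i => ∑ j, C ((g (EuclideanSpace.single j 1) i : ℝ) : ℂ) * X j

theorem eval_act (g : E d ≃ₗᵢ[ℝ] E d) (p : Poly d) (x : E d) :
    eval (toComplex x) (act g p) = eval (toComplex (g x)) p := by
  have hx : ∀ i, (g x) i = ∑ j, g (EuclideanSpace.single j 1) i * x j := by
    intro i
    have h : x = ∑ j, x j • EuclideanSpace.single j (1 : ℝ) := by
      ext l
      simp [Finset.sum_apply, Pi.single_apply]
    conv_lhs => rw [h]
    simp [map_sum, mul_comm]
  induction p using MvPolynomial.induction_on with
  | C a => simp [act]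
  | add p q hp hq => simp [hp, hq]
  | mul_X p i hp =>
    simp only [map_mul, hp, eval_X]
    congr 1
    simp [act, toComplex, hx]

theorem linForm_dvd (α : E d) (p : Poly d) : linForm α ∣ p - act (refl α) p := by
  induction p using MvPolynomial.induction_on with
  | C a => simp [act]
  | add p q hp hq =>
    have : p + q - act (refl α) (p + q) = (p - act (refl α) p) + (q - act (refl α) q) := by
      rw [map_add]; ring
    rw [this]
    exact dvd_add hp hq
  | mul_X p i hp =>
    have hX : linForm α ∣ X i - act (refl α) (X i) := by
      refine ⟨C ((2 * α i / ‖α‖ ^ 2 : ℝ) : ℂ), ?_⟩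
      have h1 : act (refl α) (X i) = ∑ j, (C ((if i = j then 1 else 0 : ℂ)) * X j
          - C ((2 * α i / ‖α‖ ^ 2 : ℝ) : ℂ) * (C (α j : ℂ) * X j)) := by
        simp only [act, aeval_X, refl_apply]
        refine Finset.sum_congr rfl fun j _ => ?_
        rw [← mul_assoc, ← sub_mul, ← C_mul, ← C_sub]
        congr 2
        by_cases hij : i = j
        · simp [EuclideanSpace.inner_single_left, hij]
        · simp [EuclideanSpace.inner_single_left, hij] <;> ring
      rw [h1, Finset.sum_sub_distrib, ← Finset.mul_sum, linForm]
      simp [mul_comm]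
    have : p * X i - act (refl α) (p * X i)
        = (p - act (refl α) p) * X i + act (refl α) p * (X i - act (refl α) (X i)) := by
      rw [map_mul]; ring
    rw [this]
    exact dvd_add (dvd_mul_of_dvd_left hp _) (dvd_mul_of_dvd_right hX _)

/-- The polynomial `(p(x) - p(σ_α x)) / ⟨α, x⟩` (for `α ≠ 0`). -/
def divDiff (α : E d) (p : Poly d) : Poly d := Classical.choose (linForm_dvd α p)

theorem linForm_mul_divDiff (α : E d) (p : Poly d) :
    linForm α * divDiff α p = p - act (refl α) p :=
  (Classical.choose_spec (linForm_dvd α p)).symm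

/-- The directional derivative `∂_ξ`. -/
def dirDeriv (ξ : E d) (p : Poly d) : Poly d := ∑ j, C (ξ j : ℂ) * pderiv j p

/-- The Dunkl operator
`T_ξ p = ∂_ξ p + ∑_{α ∈ R_+} k(α) ⟨α, ξ⟩ (p - p ∘ σ_α) / ⟨α, ·⟩`. -/
def dunklOp (R : Finset (E d)) (β : E d) (k : E d → ℂ) (ξ : E d) (p : Poly d) : Poly d :=
  dirDeriv ξ p + ∑ α ∈ posRoots R β, C (k α * (inner ℝ α ξ : ℝ)) * divDiff α p

/-! ### The class `M^*` of parameter functions -/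

/-- The operator `A = ∑_{α ∈ R_+} k(α) L_{σ_α}`. -/
def opA (R : Finset (E d)) (β : E d) (k : E d → ℂ) : Poly d →ₗ[ℂ] Poly d :=
  ∑ α ∈ posRoots R β, k α • (act (refl α)).toLinearMap

/-- The operator `(n + ∑_{α ∈ R_+} k(α)) - A`; its restriction to the homogeneous polynomials
of degree `n` is `W_n`. -/
def opW (R : Finset (E d)) (β : E d) (k : E d → ℂ) (n : ℕ) : Poly d →ₗ[ℂ] Poly d :=
  ((n : ℂ) + ∑ α ∈ posRoots R β, k α) • LinearMap.id - opA R β k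

/-- `k ∈ M^*`: for every `n ≥ 1` the operator `W_n` is invertible on the space of homogeneous
polynomials of degree `n`. -/
def MemMStar (R : Finset (E d)) (β : E d) (k : E d → ℂ) : Prop :=
  ∀ n : ℕ, 1 ≤ n →
    Set.BijOn (opW R β k n) (homogeneousSubmodule (Fin d) ℂ n) (homogeneousSubmodule (Fin d) ℂ n)

/-! ### The intertwining operator -/

/-- `V` is a linear isomorphism of `𝒫` preserving the degree of homogeneity, fixing `1` and
intertwining the Dunkl operators with the ordinary derivatives. -/
structure IsIntertwining (R : Finset (E d)) (β : E d) (k : E d → ℂ)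
    (V : Poly d →ₗ[ℂ] Poly d) : Prop where
  bijective : Function.Bijective V
  map_homogeneous : ∀ (n : ℕ) (p : Poly d), p.IsHomogeneous n → (V p).IsHomogeneous n
  map_one : V 1 = 1
  intertwines : ∀ (ξ : E d) (p : Poly d), dunklOp R β k ξ (V p) = V (dirDeriv ξ p)

open Classical in
/-- The intertwining operator `V_k`, the operator with the properties `IsIntertwining`.  (There is
exactly one for every `k ∈ M^*`; the value `0` is a placeholder for singular `k`.) -/
def intertwiningOp (R : Finset (E d)) (β : E d) (k : E d → ℂ) : Poly d →ₗ[ℂ] Poly d :=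
  if h : ∃ V, IsIntertwining R β k V then Classical.choose h else 0

/-! ### The operator `e^{-Δ/2}`, Hermite polynomials, the kernel `L_k` -/

/-- The Laplacian on polynomials. -/
def lap (p : Poly d) : Poly d := ∑ j, pderiv j (pderiv j p)

/-- `e^{-Δ/2} p = ∑_m (-1/2)^m / m! • Δ^m p`; the terms with `m > deg p` vanish
(`lap_iterate_eq_zero`). -/
def expNegHalfLap (p : Poly d) : Poly d :=
  ∑ m ∈ Finset.range (p.totalDegree + 1), ((-1 / 2 : ℂ) ^ m / (m.factorial : ℂ)) • lap^[m] p

theorem totalDegree_pderiv_le (j : Fin d) (p : Poly d) :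
    (pderiv j p).totalDegree ≤ p.totalDegree - 1 := by
  conv_lhs => rw [p.as_sum, map_sum]
  refine totalDegree_finsetSum_le fun ν hν => ?_
  rw [pderiv_monomial]
  by_cases h : ν j = 0
  · simp [h]
  · refine (totalDegree_monomial_le _ _).trans ?_
    have h1 := le_totalDegree hν
    have h2 : (ν - Finsupp.single j 1).degree + 1 = ν.degree := by
      conv_rhs => rw [← tsub_add_cancel_of_le
        (show Finsupp.single j 1 ≤ ν by simpa [Nat.one_le_iff_ne_zero] using h)]
      simp
    have h3 : ∀ μ : Fin d →₀ ℕ, (μ.sum fun _ e => e) = μ.degree := fun μ => rfl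
    change ((ν - Finsupp.single j 1).sum fun _ e => e) ≤ _
    rw [h3] at h1 ⊢
    omega

theorem lap_iterate_eq_zero (m : ℕ) (p : Poly d) (h : p.totalDegree < m) : lap^[m] p = 0 := by
  have h0 : ∀ m, lap^[m] (0 : Poly d) = 0 := fun m => by
    induction m with
    | zero => rfl
    | succ m ih => rw [Function.iterate_succ_apply]; simpa [lap] using ih
  induction m generalizing p with
  | zero => omega
  | succ m ih =>
    rw [Function.iterate_succ_apply]
    by_cases hp : p.totalDegree = 0
    · rw [totalDegree_eq_zero_iff_eq_C.1 hp]
      simpa [lap] using h0 m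
    · refine ih _ (lt_of_le_of_lt (b := p.totalDegree - 1) ?_ (by omega))
      refine totalDegree_finsetSum_le fun j _ => ?_
      have h1 := totalDegree_pderiv_le j p
      have h2 := totalDegree_pderiv_le j (pderiv j p)
      omega

/-- `φ_ν = X^ν / (ν!)^{1/2}`. -/
def phi (ν : Fin d →₀ ℕ) : Poly d :=
  monomial ν (((Real.sqrt (∏ i, ((ν i).factorial : ℝ)))⁻¹ : ℝ) : ℂ)

/-- The normalized Hermite polynomial `H_ν = e^{-Δ/2} φ_ν`. -/
def hermitePoly (ν : Fin d →₀ ℕ) : Poly d := expNegHalfLap (phi ν)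

/-- `⟨x, y⟩^n` as a polynomial in `y` whose coefficients are polynomials in `x`. -/
def pairingPow (d n : ℕ) : MvPolynomial (Fin d) (Poly d) :=
  (∑ j, C (X j : Poly d) * X j) ^ n

/-- The polynomial `y ↦ E_n(x, y) = (1 / n!) V_k(⟨·, y⟩^n)(x)`, for `x ∈ ℂ^d`: in `⟨x, y⟩^n` the
operator `V_k` is applied to the coefficient (a polynomial in `x`) of every monomial in `y`.
See `eval_dunklE`. -/
def dunklE (R : Finset (E d)) (β : E d) (k : E d → ℂ) (n : ℕ) (x : Fin d → ℂ) : Poly d :=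
  ∑ ν ∈ (pairingPow d n).support,
    monomial ν ((n.factorial : ℂ)⁻¹ * eval x (intertwiningOp R β k (coeff ν (pairingPow d n))))

theorem eval_dunklE (R : Finset (E d)) (β : E d) (k : E d → ℂ) (n : ℕ) (x y : Fin d → ℂ) :
    eval y (dunklE R β k n x)
      = (n.factorial : ℂ)⁻¹ * eval x (intertwiningOp R β k ((∑ j, C (y j) * X j) ^ n)) := by
  have h : (∑ j, C (y j) * X j : Poly d) ^ n =
      eval (fun j => (C (y j) : Poly d)) (pairingPow d n) := by
    simp [pairingPow, mul_comm]
  rw [h, eval_eq' _ (pairingPow d n), map_sum, map_sum, Finset.mul_sum, dunklE, map_sum]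
  refine Finset.sum_congr rfl fun ν _ => ?_
  have h2 : coeff ν (pairingPow d n) * ∏ i, (C (y i) : Poly d) ^ ν i
      = (∏ i, y i ^ ν i) • coeff ν (pairingPow d n) := by
    rw [smul_eq_C_mul, map_prod, mul_comm]
    simp
  rw [h2, map_smul, eval_monomial, smul_eval, Finsupp.prod_fintype _ _ (by simp)]
  ring

/-- The kernel `L_k(x, y) = ∑_n (e^{-Δ/2} E_n(x, ·))(y)`, for `x ∈ ℂ^d` and `y ∈ ℝ^d`. -/
def kernelL (R : Finset (E d)) (β : E d) (k : E d → ℂ) (x : Fin d → ℂ) (y : E d) : ℂ :=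
  ∑' n : ℕ, eval (toComplex y) (expNegHalfLap (dunklE R β k n x))

/-! ### The Gaussian measure -/

/-- `c_0 = (2π)^{d/2}`. -/
def c0 (d : ℕ) : ℝ := (2 * Real.pi) ^ ((d : ℝ) / 2)

/-- The Gaussian probability measure `dγ = c_0⁻¹ e^{-‖z‖²/2} dz` on `ℝ^d`. -/
def gauss (d : ℕ) : Measure (E d) :=
  volume.withDensity fun z => ENNReal.ofReal ((c0 d)⁻¹ * Real.exp (-‖z‖ ^ 2 / 2))

end Dunkl

end

/-! By the multinomial theorem `⟨x, y⟩^n / n! = ∑_{|ν| = n} φ_ν(x) φ_ν(y)`. Applying `V_k` in `x`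
and `e^{-Δ/2}` in `y` gives `∑_{|ν| = n} V_k(φ_ν)(x) H_ν(y)` (`dunklE_eq_sum`), so the expansion
holds degree by degree and only convergence is at stake.

The decisive estimate is that `V_k(φ_ν)(x)` decays faster than any geometric sequence in `|ν|`
(`exists_norm_intertwiningOp_phi_le`). Euler's identity and the intertwining relation give `W_n V_k
p = ∑ x_i V_k(∂_i p)` for `p` homogeneous of degree `n`. On a ball of radius `r` in `ℂ^d`, which the
reflections preserve, `W_n` is bounded below in sup norm by `n - 2S`, where `S = ∑ |k(α)|`. Since
`∂_i φ_ν` is at most `√n` times some `φ_μ` with `|μ| = n - 1`, passing from degree `n - 1` to `n`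
costs a factor `d r √n / (n - 2S)`, which tends to `0`.

Since `|H_ν(y)| ≤ (1 + ‖y‖)^|ν|`, the expansion converges absolutely at every point. The `H_ν` are
orthonormal in `L²(γ)`, because `e^{-Δ/2}` turns multiplication by `x_i` into `x_i - ∂_i`, the
Gaussian adjoint of `∂_i`. Hence the series also converges absolutely in `L²(γ)`, to the same limit.
The norm identity is Parseval's, as `e^{-‖y‖²/2}` is `c_0` times the density of `γ`. -/

namespace Dunkl

variable {d : ℕ}

/-! ### Complexified orthogonal maps -/

/-- The complex-linear extension of an orthogonal map to `ℂ^d`. -/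
noncomputable def complexAct (g : E d ≃ₗᵢ[ℝ] E d) (x : Fin d → ℂ) : Fin d → ℂ :=
  fun i => ∑ j, ((g (EuclideanSpace.single j 1) i : ℝ) : ℂ) * x j

theorem eval_act_complex (g : E d ≃ₗᵢ[ℝ] E d) (p : Poly d) (x : Fin d → ℂ) :
    eval x (act g p) = eval (complexAct g x) p := by
  induction p using MvPolynomial.induction_on with
  | C a => simp [act]
  | add p q hp hq => simp [hp, hq]
  | mul_X p i hp =>
    simp only [map_mul, hp, eval_X]
    congr 1
    simp [act, complexAct]

theorem apply_eq_sum_single (g : E d ≃ₗᵢ[ℝ] E d) (u : E d) (i : Fin d) :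
    g u i = ∑ j, g (EuclideanSpace.single j 1) i * u j := by
  have h : u = ∑ j, u j • EuclideanSpace.single j (1 : ℝ) := by
    ext l
    simp [Finset.sum_apply, Pi.single_apply]
  conv_lhs => rw [h]
  simp [map_sum, mul_comm]

theorem sum_sq_apply (g : E d ≃ₗᵢ[ℝ] E d) (u : E d) : ∑ i, g u i ^ 2 = ∑ i, u i ^ 2 := by
  rw [← EuclideanSpace.real_norm_sq_eq, ← EuclideanSpace.real_norm_sq_eq, g.norm_map]

/-- The matrix of `g` is real, so real and imaginary parts are moved separately, each by the
isometry `g`. -/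
theorem sum_norm_sq_complexAct (g : E d ≃ₗᵢ[ℝ] E d) (x : Fin d → ℂ) :
    ∑ i, ‖complexAct g x i‖ ^ 2 = ∑ i, ‖x i‖ ^ 2 := by
  have hre : ∀ i, (complexAct g x i).re = g (WithLp.toLp 2 fun i => (x i).re) i := fun i => by
    rw [apply_eq_sum_single]; simp [complexAct]
  have him : ∀ i, (complexAct g x i).im = g (WithLp.toLp 2 fun i => (x i).im) i := fun i => by
    rw [apply_eq_sum_single]; simp [complexAct]
  have hn : ∀ z : ℂ, ‖z‖ ^ 2 = z.re ^ 2 + z.im ^ 2 := fun z => by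
    rw [← Complex.normSq_eq_norm_sq, Complex.normSq_apply]; ring
  simp only [hn, hre, him, Finset.sum_add_distrib, sum_sq_apply]

/-! ### The Euler identity for Dunkl operators -/

theorem dirDeriv_single (i : Fin d) (p : Poly d) :
    dirDeriv (EuclideanSpace.single i 1) p = pderiv i p := by
  rw [dirDeriv, Finset.sum_eq_single i]
  · simp
  · intro j _ hj
    simp [hj]
  · simp

/-- Multiplying by `x_i` and summing turns `⟨α, e_i⟩` into `⟨α, x⟩`, which cancels the denominator
of the difference quotient; the derivatives contribute `n p` by Euler's identity. -/
theorem opW_eq_sum_X_mul_dunklOp (R : Finset (E d)) (β : E d) (k : E d → ℂ) {n : ℕ} {p : Poly d}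
    (hp : p.IsHomogeneous n) :
    opW R β k n p = ∑ i, X i * dunklOp R β k (EuclideanSpace.single i 1) p := by
  have h : ∀ α ∈ posRoots R β,
      ∑ i, X i * (C (k α * (inner ℝ α (EuclideanSpace.single i 1) : ℝ)) * divDiff α p)
        = k α • (p - act (refl α) p) := by
    intro α _
    rw [← linForm_mul_divDiff, linForm, Finset.sum_mul, Finset.smul_sum]
    refine Finset.sum_congr rfl fun i _ => ?_
    rw [smul_eq_C_mul, C_mul, EuclideanSpace.inner_single_right]
    simp only [starRingEnd_apply, star_trivial, one_mul]
    ring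
  simp only [dunklOp, dirDeriv_single, mul_add, Finset.sum_add_distrib, hp.sum_X_mul_pderiv,
    Finset.mul_sum]
  rw [Finset.sum_comm, Finset.sum_congr rfl h]
  simp only [opW, opA, LinearMap.sub_apply, LinearMap.smul_apply,
    LinearMap.sum_apply, AlgHom.toLinearMap_apply, smul_sub, Finset.sum_sub_distrib, add_smul,
    ← Finset.sum_smul, Nat.cast_smul_eq_nsmul]
  exact add_sub_assoc _ _ _

/-! ### The intertwining operator

The estimates below use only that `V_k` preserves homogeneity and intertwines the Dunkl operators
with the derivatives, so they hold for every operator with the properties `IsIntertwining`; the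
placeholder value has these two properties as well. -/

theorem intertwiningOp_isHomogeneous (R : Finset (E d)) (β : E d) (k : E d → ℂ) {n : ℕ}
    {p : Poly d} (hp : p.IsHomogeneous n) : (intertwiningOp R β k p).IsHomogeneous n := by
  by_cases h : ∃ V, IsIntertwining R β k V
  · rw [intertwiningOp, dif_pos h]
    exact (Classical.choose_spec h).map_homogeneous n p hp
  · rw [intertwiningOp, dif_neg h]
    exact isHomogeneous_zero _ _ _

/-- `divDiff` is a chosen quotient, so its value at `0` is known only after cancelling `⟨α, ·⟩`.
This form is nonzero, since `⟨α, β⟩ > 0` excludes `α = 0`. -/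
theorem dunklOp_zero (R : Finset (E d)) (β ξ : E d) (k : E d → ℂ) :
    dunklOp R β k ξ 0 = 0 := by
  have h : ∀ α ∈ posRoots R β, divDiff α (0 : Poly d) = 0 := by
    intro α hα
    have hα0 : α ≠ 0 := by
      rintro rfl
      simp [posRoots] at hα
    have hlin : linForm α ≠ 0 := by
      intro h0
      apply hα0
      ext i
      have := congrArg (eval (Pi.single i (1 : ℂ))) h0
      simpa [linForm, Pi.single_apply] using this
    have := linForm_mul_divDiff α (0 : Poly d)
    rw [map_zero, sub_zero] at this
    exact (mul_eq_zero.1 this).resolve_left hlin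
  rw [dunklOp, Finset.sum_eq_zero fun α hα => by rw [h α hα, mul_zero]]
  simp [dirDeriv]

theorem dunklOp_intertwiningOp (R : Finset (E d)) (β ξ : E d) (k : E d → ℂ) (p : Poly d) :
    dunklOp R β k ξ (intertwiningOp R β k p) = intertwiningOp R β k (dirDeriv ξ p) := by
  by_cases h : ∃ V, IsIntertwining R β k V
  · rw [intertwiningOp, dif_pos h]
    exact (Classical.choose_spec h).intertwines ξ p
  · rw [intertwiningOp, dif_neg h]
    exact dunklOp_zero R β ξ k

theorem opW_intertwiningOp (R : Finset (E d)) (β : E d) (k : E d → ℂ) {n : ℕ} {p : Poly d}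
    (hp : p.IsHomogeneous n) :
    opW R β k n (intertwiningOp R β k p) = ∑ i, X i * intertwiningOp R β k (pderiv i p) := by
  rw [opW_eq_sum_X_mul_dunklOp R β k (intertwiningOp_isHomogeneous R β k hp)]
  simp only [dunklOp_intertwiningOp R β _ k, dirDeriv_single]

/-! ### The polynomials `φ_ν` -/

theorem prod_factorial_add_single (ν : Fin d →₀ ℕ) (i : Fin d) :
    (∏ j, (((ν + Finsupp.single i 1 : Fin d →₀ ℕ) j).factorial : ℝ)) = (ν i + 1) *
      ∏ j, ((ν j).factorial : ℝ) := by
  rw [← Finset.mul_prod_erase _ _ (Finset.mem_univ i),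
    ← Finset.mul_prod_erase _ (fun j => ((ν j).factorial : ℝ)) (Finset.mem_univ i)]
  have h : ∀ j ∈ Finset.univ.erase i, (((ν + Finsupp.single i 1 : Fin d →₀ ℕ) j).factorial : ℝ)
      = ((ν j).factorial : ℝ) := fun j hj => by
    rw [Finsupp.add_apply, Finsupp.single_eq_of_ne (Finset.ne_of_mem_erase hj), add_zero]
  rw [Finset.prod_congr rfl h, Finsupp.add_apply, Finsupp.single_eq_same, Nat.factorial_succ]
  push_cast
  ring

theorem prod_factorial_pos (ν : Fin d →₀ ℕ) : 0 < ∏ j, ((ν j).factorial : ℝ) :=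
  Finset.prod_pos fun _ _ => by positivity

theorem phi_isHomogeneous (ν : Fin d →₀ ℕ) : (phi ν).IsHomogeneous ν.degree :=
  isHomogeneous_monomial _ rfl

theorem X_mul_phi (ν : Fin d →₀ ℕ) (i : Fin d) :
    X i * phi ν = ((Real.sqrt (ν i + 1) : ℝ) : ℂ) • phi (ν + Finsupp.single i 1) := by
  have h : Real.sqrt (ν i + 1) ≠ 0 := (Real.sqrt_pos.2 (by positivity)).ne'
  rw [phi, phi, mul_comm, X, monomial_mul, smul_monomial, prod_factorial_add_single,
    Real.sqrt_mul (by positivity), smul_eq_mul, mul_one, ← Complex.ofReal_mul, mul_inv,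
    mul_inv_cancel_left₀ h]

theorem pderiv_phi_add_single (ν : Fin d →₀ ℕ) (i : Fin d) :
    pderiv i (phi (ν + Finsupp.single i 1)) = ((Real.sqrt (ν i + 1) : ℝ) : ℂ) • phi ν := by
  have h : Real.sqrt (ν i + 1) ≠ 0 := (Real.sqrt_pos.2 (by positivity)).ne'
  have h2 : (ν i + 1 : ℝ) = Real.sqrt (ν i + 1) * Real.sqrt (ν i + 1) :=
    (Real.mul_self_sqrt (by positivity)).symm
  rw [phi, phi, pderiv_monomial, smul_monomial, prod_factorial_add_single,
    Real.sqrt_mul (by positivity), smul_eq_mul, add_tsub_cancel_right]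
  congr 1
  rw [Finsupp.add_apply, Finsupp.single_eq_same, mul_inv]
  have h3 : (((ν i + 1 : ℕ) : ℂ)) = ((ν i + 1 : ℝ) : ℂ) := by push_cast; rfl
  rw [h3, ← Complex.ofReal_mul, ← Complex.ofReal_mul]
  congr 1
  nth_rewrite 2 [h2]
  field_simp

theorem pderiv_phi_of_eq_zero {ν : Fin d →₀ ℕ} {i : Fin d} (h : ν i = 0) :
    pderiv i (phi ν) = 0 := by
  rw [phi, pderiv_monomial, h]
  simp

theorem eq_add_single_of_ne_zero {ν : Fin d →₀ ℕ} {i : Fin d} (h : ν i ≠ 0) :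
    ∃ μ, ν = μ + Finsupp.single i 1 :=
  ⟨ν - Finsupp.single i 1, (tsub_add_cancel_of_le
    (show Finsupp.single i 1 ≤ ν by simpa [Nat.one_le_iff_ne_zero] using h)).symm⟩

/-! ### Decay of `V_k(φ_ν)` -/

theorem isCompact_complexBall (r : ℝ) : IsCompact {x : Fin d → ℂ | ∑ i, ‖x i‖ ^ 2 ≤ r ^ 2} := by
  refine Metric.isCompact_of_isClosed_isBounded
    (isClosed_le (by fun_prop) continuous_const) ?_
  refine (Metric.isBounded_closedBall (x := (0 : Fin d → ℂ)) (r := |r|)).subset fun x hx => ?_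
  rw [mem_closedBall_zero_iff, pi_norm_le_iff_of_nonneg (abs_nonneg r)]
  intro i
  refine abs_le_of_sq_le_sq' ?_ (abs_nonneg r) |>.2
  rw [sq_abs]
  exact (Finset.single_le_sum (f := fun i => ‖x i‖ ^ 2) (fun _ _ => by positivity)
    (Finset.mem_univ i)).trans hx

/-- Evaluate `W_n p` at a point `z` of the ball where `|p|` is maximal. The reflected points stay in
the ball, so every term other than `n p(z)` is controlled by `|p(z)|`, with total weight `2 ∑
|k(α)|`. -/
theorem mul_bound_le_of_opW (R : Finset (E d)) (β : E d) (k : E d → ℂ) {n : ℕ} {p : Poly d}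
    {r B : ℝ} (hn : 2 * ∑ α ∈ posRoots R β, ‖k α‖ ≤ n)
    (hB : ∀ x : Fin d → ℂ, ∑ i, ‖x i‖ ^ 2 ≤ r ^ 2 → ‖eval x (opW R β k n p)‖ ≤ B)
    {x : Fin d → ℂ} (hx : ∑ i, ‖x i‖ ^ 2 ≤ r ^ 2) :
    (n - 2 * ∑ α ∈ posRoots R β, ‖k α‖) * ‖eval x p‖ ≤ B := by
  set S := ∑ α ∈ posRoots R β, ‖k α‖
  obtain ⟨z, hz, hmax⟩ := (isCompact_complexBall (d := d) r).exists_isMaxOn ⟨x, hx⟩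
    (f := fun x => ‖eval x p‖) (MvPolynomial.continuous_eval p).norm.continuousOn
  have hWz : eval z (opW R β k n p) = n * eval z p + ((∑ α ∈ posRoots R β, k α) * eval z p
      - ∑ α ∈ posRoots R β, k α * eval (complexAct (refl α) z) p) := by
    simp only [opW, opA, LinearMap.sub_apply, LinearMap.smul_apply, LinearMap.id_apply,
      LinearMap.sum_apply, AlgHom.toLinearMap_apply, map_sub, smul_eval, map_sum,
      eval_act_complex]
    ring
  have h1 : ‖(∑ α ∈ posRoots R β, k α) * eval z p
      - ∑ α ∈ posRoots R β, k α * eval (complexAct (refl α) z) p‖ ≤ 2 * S * ‖eval z p‖ := by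
    refine (norm_sub_le _ _).trans ?_
    have ha : ‖(∑ α ∈ posRoots R β, k α) * eval z p‖ ≤ S * ‖eval z p‖ := by
      rw [norm_mul]
      gcongr
      exact norm_sum_le _ _
    have hb : ‖∑ α ∈ posRoots R β, k α * eval (complexAct (refl α) z) p‖ ≤ S * ‖eval z p‖ := by
      rw [Finset.sum_mul]
      refine norm_sum_le_of_le _ fun α _ => ?_
      rw [norm_mul]
      gcongr
      refine hmax ?_
      rw [Set.mem_ofPred_eq, sum_norm_sq_complexAct]
      exact hz
    linarith
  have h2 : (n : ℝ) * ‖eval z p‖ - 2 * S * ‖eval z p‖ ≤ ‖eval z (opW R β k n p)‖ := by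
    rw [hWz]
    refine le_trans ?_ (norm_sub_le_norm_add _ _)
    rw [norm_mul, Complex.norm_natCast]
    linarith
  calc (n - 2 * S) * ‖eval x p‖ ≤ (n - 2 * S) * ‖eval z p‖ := by
        exact mul_le_mul_of_nonneg_left (hmax hx) (by linarith)
    _ ≤ B := by linarith [hB z hz]

theorem norm_intertwiningOp_phi_step (R : Finset (E d)) (β : E d) (k : E d → ℂ)
    {n : ℕ} {r B : ℝ} (hr : 0 ≤ r)
    (hn : 2 * ∑ α ∈ posRoots R β, ‖k α‖ ≤ (n + 1 : ℕ))
    (hB : ∀ ν : Fin d →₀ ℕ, ν.degree = n → ∀ x : Fin d → ℂ, ∑ i, ‖x i‖ ^ 2 ≤ r ^ 2 →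
      ‖eval x (intertwiningOp R β k (phi ν))‖ ≤ B) (hB0 : 0 ≤ B)
    {ν : Fin d →₀ ℕ} (hν : ν.degree = n + 1) {x : Fin d → ℂ} (hx : ∑ i, ‖x i‖ ^ 2 ≤ r ^ 2) :
    ((n + 1 : ℕ) - 2 * ∑ α ∈ posRoots R β, ‖k α‖) * ‖eval x (intertwiningOp R β k (phi ν))‖
      ≤ d * (r * Real.sqrt (n + 1)) * B := by
  refine mul_bound_le_of_opW R β k hn (fun z hz => ?_) hx
  rw [opW_intertwiningOp R β k (hν ▸ phi_isHomogeneous ν), map_sum]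
  refine (norm_sum_le _ _).trans ?_
  have h : ∀ i ∈ Finset.univ, ‖eval z (X i * intertwiningOp R β k (pderiv i (phi ν)))‖
      ≤ r * Real.sqrt (n + 1) * B := by
    intro i _
    by_cases hi : ν i = 0
    · rw [pderiv_phi_of_eq_zero hi]
      simp only [map_zero, mul_zero, norm_zero]
      positivity
    obtain ⟨μ, rfl⟩ := eq_add_single_of_ne_zero hi
    have hμ : μ.degree = n := by simpa using hν
    rw [pderiv_phi_add_single, map_smul, map_mul, eval_X, smul_eval, norm_mul, norm_mul,
      Complex.norm_real, Real.norm_of_nonneg (Real.sqrt_nonneg _), ← mul_assoc]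
    have hzi : ‖z i‖ ≤ r := by
      refine abs_le_of_sq_le_sq' ?_ hr |>.2
      exact (Finset.single_le_sum (f := fun i => ‖z i‖ ^ 2) (fun _ _ => by positivity)
        (Finset.mem_univ i)).trans hz
    have hμi : (μ i : ℝ) ≤ n := by
      rw [← hμ]
      exact_mod_cast Finsupp.le_degree i μ
    gcongr
    exact hB μ hμ z hz
  refine (Finset.sum_le_card_nsmul _ _ _ h).trans ?_
  simp [mul_assoc]

theorem eventually_step_ratio_le (c S ε : ℝ) (hε : 0 < ε) :
    ∃ N : ℕ, 2 * S ≤ N ∧ ∀ n : ℕ, N ≤ n →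
      c * Real.sqrt (n + 1) ≤ ε * ((n + 1 : ℕ) - 2 * S) := by
  -- `n ≥ 4S` gives `n + 1 - 2S ≥ (n + 1) / 2`; the squared entry gives `√(n + 1) ≥ 2|c| / ε`.
  obtain ⟨N, hN⟩ := exists_nat_ge (max (max (2 * S) (4 * S)) ((2 * |c| / ε) ^ 2))
  refine ⟨N, ((le_max_left _ _).trans (le_max_left _ _)).trans hN, fun n hn => ?_⟩
  have hn' : (N : ℝ) ≤ n := by exact_mod_cast hn
  have h1 : 4 * S ≤ n := (((le_max_right _ _).trans (le_max_left _ _)).trans hN).trans hn'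
  have h2 : (2 * |c| / ε) ^ 2 ≤ n := ((le_max_right _ _).trans hN).trans hn'
  have h3 : 2 * |c| / ε ≤ Real.sqrt (n + 1) := Real.le_sqrt_of_sq_le (by linarith)
  have h4 : 2 * |c| ≤ Real.sqrt (n + 1) * ε := (div_le_iff₀ hε).1 h3
  have h5 : Real.sqrt (n + 1) * Real.sqrt (n + 1) = (n + 1 : ℝ) :=
    Real.mul_self_sqrt (by positivity)
  have h6 : c * Real.sqrt (n + 1) ≤ |c| * Real.sqrt (n + 1) := by
    gcongr
    exact le_abs_self c
  have h7 : 2 * |c| * Real.sqrt (n + 1) ≤ ε * (n + 1 : ℝ) := by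
    calc 2 * |c| * Real.sqrt (n + 1) ≤ Real.sqrt (n + 1) * ε * Real.sqrt (n + 1) := by gcongr
      _ = ε * (Real.sqrt (n + 1) * Real.sqrt (n + 1)) := by ring
      _ = ε * (n + 1 : ℝ) := by rw [h5]
  push_cast
  nlinarith

theorem finite_degree_le (N : ℕ) : {ν : Fin d →₀ ℕ | ν.degree ≤ N}.Finite := by
  refine (Set.finite_Iic (Finsupp.equivFunOnFinite.symm fun _ => N)).subset fun ν hν i => ?_
  exact (Finsupp.le_degree i ν).trans hν

/-- `V_k(φ_ν)` decays faster than every geometric sequence in the degree of `ν`. -/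
theorem exists_norm_intertwiningOp_phi_le (R : Finset (E d)) (β : E d) (k : E d → ℂ)
    (x : Fin d → ℂ) {ε : ℝ} (hε : 0 < ε) :
    ∃ M : ℝ, 0 ≤ M ∧ ∀ ν : Fin d →₀ ℕ,
      ‖eval x (intertwiningOp R β k (phi ν))‖ ≤ M * ε ^ ν.degree := by
  set S := ∑ α ∈ posRoots R β, ‖k α‖
  set r := Real.sqrt (∑ i, ‖x i‖ ^ 2)
  have hr : 0 ≤ r := Real.sqrt_nonneg _
  have hxr : ∑ i, ‖x i‖ ^ 2 ≤ r ^ 2 :=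
    (Real.sq_sqrt (Finset.sum_nonneg fun _ _ => by positivity)).ge
  obtain ⟨N, hNS, hN⟩ := eventually_step_ratio_le (d * r) S ε hε
  have hlow : ∀ ν : Fin d →₀ ℕ, ∃ M : ℝ, 0 ≤ M ∧ ∀ x : Fin d → ℂ, ∑ i, ‖x i‖ ^ 2 ≤ r ^ 2 →
      ‖eval x (intertwiningOp R β k (phi ν))‖ ≤ M * ε ^ ν.degree := by
    intro ν
    obtain ⟨M, hM⟩ := (isCompact_complexBall (d := d) r).exists_bound_of_continuousOn
      (f := fun x => eval x (intertwiningOp R β k (phi ν)))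
      (MvPolynomial.continuous_eval _).continuousOn
    refine ⟨max M 0 / ε ^ ν.degree, by positivity, fun x hx => ?_⟩
    rw [div_mul_cancel₀ _ (by positivity)]
    exact (hM x hx).trans (le_max_left _ _)
  choose M hM0 hM using hlow
  -- One constant for all degrees up to `N`: there are finitely many such `ν`, each bounded on the
  -- compact ball.
  set T := ∑ ν ∈ (finite_degree_le (d := d) N).toFinset, M ν
  have hT0 : 0 ≤ T := Finset.sum_nonneg fun ν _ => hM0 ν
  -- The induction must run uniformly over the ball, because each step passes to a maximum point.
  have key : ∀ n : ℕ, ∀ ν : Fin d →₀ ℕ, ν.degree = n → ∀ x : Fin d → ℂ, ∑ i, ‖x i‖ ^ 2 ≤ r ^ 2 →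
      ‖eval x (intertwiningOp R β k (phi ν))‖ ≤ T * ε ^ n := by
    have low : ∀ n ≤ N, ∀ ν : Fin d →₀ ℕ, ν.degree = n → ∀ x : Fin d → ℂ,
        ∑ i, ‖x i‖ ^ 2 ≤ r ^ 2 → ‖eval x (intertwiningOp R β k (phi ν))‖ ≤ T * ε ^ n := by
      rintro n hn ν rfl x hx
      refine (hM ν x hx).trans ?_
      gcongr
      exact Finset.single_le_sum (f := M) (fun ν _ => hM0 ν) (by simpa using hn)
    intro n
    induction n with
    | zero => exact low 0 (Nat.zero_le _)
    | succ n ih =>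
      by_cases hn : n + 1 ≤ N
      · exact low _ hn
      intro ν hν z hz
      have hn' : (N : ℝ) + 1 ≤ (n + 1 : ℕ) := by exact_mod_cast (by omega : N + 1 ≤ n + 1)
      have h1 := norm_intertwiningOp_phi_step R β k (B := T * ε ^ n) hr (by linarith) ih
        (by positivity) hν hz
      have h2 := hN n (by omega)
      -- Strict, because `2S ≤ N < n + 1`.
      have h3 : (0 : ℝ) < (n + 1 : ℕ) - 2 * S := by linarith
      refine le_of_mul_le_mul_left (h1.trans ?_) h3
      calc d * (r * Real.sqrt (n + 1)) * (T * ε ^ n)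
          = d * r * Real.sqrt (n + 1) * (T * ε ^ n) := by ring
        _ ≤ ε * ((n + 1 : ℕ) - 2 * S) * (T * ε ^ n) := by gcongr
        _ = _ := by ring
  exact ⟨T, hT0, fun ν => key _ ν rfl x hxr⟩

/-! ### The operator `e^{-Δ/2}` -/

/-- The Laplacian as a linear map. -/
noncomputable def lapLin (d : ℕ) : Module.End ℂ (Poly d) :=
  ∑ j, (pderiv j).toLinearMap ∘ₗ (pderiv j).toLinearMap

theorem lapLin_apply (p : Poly d) : lapLin d p = lap p := by
  simp [lapLin, lap]

theorem lapLin_pow_apply (m : ℕ) (p : Poly d) : (lapLin d ^ m) p = lap^[m] p := by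
  rw [Module.End.pow_apply]
  exact congrArg (fun f : Poly d → Poly d => f^[m] p) (funext lapLin_apply)

/-- The partial sums of the exponential series for `e^{-Δ/2}`. -/
noncomputable def expLapPartial (d N : ℕ) : Module.End ℂ (Poly d) :=
  ∑ m ∈ Finset.range N, ((-1 / 2 : ℂ) ^ m / (m.factorial : ℂ)) • lapLin d ^ m

/-- The cut-off in `expNegHalfLap` depends on `p`, which hides linearity; a common larger cut-off
replaces it by a linear map. -/
theorem expNegHalfLap_eq_partial {N : ℕ} {p : Poly d} (h : p.totalDegree < N) :
    expNegHalfLap p = expLapPartial d N p := by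
  simp only [expNegHalfLap, expLapPartial, LinearMap.sum_apply, LinearMap.smul_apply,
    lapLin_pow_apply]
  refine Finset.sum_subset (Finset.range_mono h) fun m _ hm => ?_
  rw [lap_iterate_eq_zero m p (by simpa using hm), smul_zero]

theorem expNegHalfLap_sum {ι : Type*} (s : Finset ι) (c : ι → ℂ) (p : ι → Poly d) :
    expNegHalfLap (∑ i ∈ s, c i • p i) = ∑ i ∈ s, c i • expNegHalfLap (p i) := by
  set N := (∑ i ∈ s, c i • p i).totalDegree + ∑ i ∈ s, (p i).totalDegree + 1
  rw [expNegHalfLap_eq_partial (N := N) (by omega), map_sum]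
  refine Finset.sum_congr rfl fun i hi => ?_
  have := Finset.single_le_sum (f := fun i => (p i).totalDegree) (fun _ _ => Nat.zero_le _) hi
  rw [map_smul, expNegHalfLap_eq_partial (N := N) (by omega)]

theorem expNegHalfLap_smul (c : ℂ) (p : Poly d) :
    expNegHalfLap (c • p) = c • expNegHalfLap p := by
  simpa using expNegHalfLap_sum {()} (fun _ => c) (fun _ => p)

theorem pderiv_pderiv_comm (i j : Fin d) (p : Poly d) :
    pderiv i (pderiv j p) = pderiv j (pderiv i p) := by
  induction p using MvPolynomial.induction_on' with
  | monomial ν a =>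
    by_cases h : i = j
    · rw [h]
    · simp only [pderiv_monomial]
      rw [tsub_right_comm (a := ν)]
      simp [h, Ne.symm h, mul_right_comm]
  | add p q hp hq => simp [hp, hq]

theorem pderiv_lapLin (i : Fin d) (p : Poly d) :
    pderiv i (lapLin d p) = lapLin d (pderiv i p) := by
  simp only [lapLin_apply, lap, map_sum]
  exact Finset.sum_congr rfl fun j _ => by rw [pderiv_pderiv_comm, pderiv_pderiv_comm i j p]

theorem pderiv_lapLin_pow (i : Fin d) (m : ℕ) (p : Poly d) :
    pderiv i ((lapLin d ^ m) p) = (lapLin d ^ m) (pderiv i p) := by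
  induction m with
  | zero => rfl
  | succ m ih => rw [pow_succ', Module.End.mul_apply, pderiv_lapLin, ih, Module.End.mul_apply]

/-- The commutator relation `[Δ, x_i] = 2 ∂_i`, from which the conjugation of `x_i` by `e^{-Δ/2}`
follows. -/
theorem lapLin_X_mul (i : Fin d) (p : Poly d) :
    lapLin d (X i * p) = X i * lapLin d p + (2 : ℂ) • pderiv i p := by
  have h : ∀ j, pderiv j (pderiv j (X i * p))
      = X i * pderiv j (pderiv j p) + if j = i then (2 : ℂ) • pderiv i p else 0 := by
    intro j
    by_cases hj : j = i
    · subst hj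
      simp only [Derivation.leibniz, pderiv_X_self, smul_eq_mul, mul_one, map_add, if_true, two_smul]
      ring
    · simp [Derivation.leibniz, pderiv_X_of_ne (Ne.symm hj), hj]
  simp only [lapLin_apply, lap, h, Finset.sum_add_distrib, ← Finset.mul_sum, Finset.sum_ite_eq',
    Finset.mem_univ, if_true]

theorem lapLin_pow_X_mul (i : Fin d) (m : ℕ) (p : Poly d) :
    (lapLin d ^ (m + 1)) (X i * p)
      = X i * (lapLin d ^ (m + 1)) p + (2 * (m + 1) : ℂ) • pderiv i ((lapLin d ^ m) p) := by
  induction m with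
  | zero => simp [lapLin_X_mul]
  | succ m ih =>
    rw [pow_succ', Module.End.mul_apply, ih, map_add, lapLin_X_mul, map_smul, ← pderiv_lapLin,
      ← Module.End.mul_apply, ← Module.End.mul_apply, ← pow_succ', ← pow_succ', add_assoc,
      ← add_smul]
    congr 2
    push_cast
    ring

/-- The commutator of `Δ^{m+1}` with `x_i` contains only `Δ^m`, hence one term fewer under the
derivative. -/
theorem expLapPartial_X_mul (i : Fin d) (N : ℕ) (p : Poly d) :
    expLapPartial d (N + 1) (X i * p)
      = X i * expLapPartial d (N + 1) p - pderiv i (expLapPartial d N p) := by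
  induction N with
  | zero => simp [expLapPartial]
  | succ N ih =>
    have h : ∀ M, ∀ q : Poly d, expLapPartial d (M + 1) q = expLapPartial d M q
        + ((-1 / 2 : ℂ) ^ M / (M.factorial : ℂ)) • (lapLin d ^ M) q := fun M q => by
      rw [expLapPartial, Finset.sum_range_succ]; rfl
    rw [h (N + 1), ih, lapLin_pow_X_mul, h (N + 1) p, h N p]
    simp only [map_add, Derivation.map_smul, smul_add, mul_add (X i), smul_smul, mul_smul_comm]
    have hc : (-1 / 2 : ℂ) ^ (N + 1) / ((N + 1).factorial : ℂ) * (2 * (N + 1))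
        = -((-1 / 2 : ℂ) ^ N / (N.factorial : ℂ)) := by
      rw [Nat.factorial_succ]
      have h1 : (N.factorial : ℂ) ≠ 0 := by exact_mod_cast N.factorial_ne_zero
      have h2 : (N + 1 : ℂ) ≠ 0 := by exact_mod_cast N.succ_ne_zero
      push_cast
      field_simp
      ring
    rw [hc, neg_smul]
    ring

theorem expNegHalfLap_X_mul (i : Fin d) (p : Poly d) :
    expNegHalfLap (X i * p) = X i * expNegHalfLap p - pderiv i (expNegHalfLap p) := by
  set N := p.totalDegree + (X i * p).totalDegree + 1
  rw [expNegHalfLap_eq_partial (N := N + 1) (by omega), expLapPartial_X_mul,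
    ← expNegHalfLap_eq_partial (by omega), ← expNegHalfLap_eq_partial (by omega)]

theorem pderiv_expNegHalfLap (i : Fin d) (p : Poly d) :
    pderiv i (expNegHalfLap p) = expNegHalfLap (pderiv i p) := by
  set N := p.totalDegree + (pderiv i p).totalDegree + 1
  rw [expNegHalfLap_eq_partial (N := N) (by omega), expNegHalfLap_eq_partial (N := N) (by omega)]
  simp only [expLapPartial, LinearMap.sum_apply, LinearMap.smul_apply, map_sum,
    Derivation.map_smul, pderiv_lapLin_pow]

/-! ### Hermite polynomials -/

theorem phi_zero : (phi 0 : Poly d) = 1 := by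
  simp [phi]

theorem hermitePoly_zero : (hermitePoly 0 : Poly d) = 1 := by
  have h : (1 : Poly d).totalDegree < 1 := by simp
  rw [hermitePoly, phi_zero, expNegHalfLap_eq_partial h]
  simp [expLapPartial]

theorem smul_hermitePoly_add_single (ν : Fin d →₀ ℕ) (i : Fin d) :
    ((Real.sqrt (ν i + 1) : ℝ) : ℂ) • hermitePoly (ν + Finsupp.single i 1)
      = X i * hermitePoly ν - pderiv i (hermitePoly ν) := by
  rw [hermitePoly, hermitePoly, ← expNegHalfLap_smul, ← X_mul_phi, expNegHalfLap_X_mul]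

theorem pderiv_hermitePoly_add_single (ν : Fin d →₀ ℕ) (i : Fin d) :
    pderiv i (hermitePoly (ν + Finsupp.single i 1))
      = ((Real.sqrt (ν i + 1) : ℝ) : ℂ) • hermitePoly ν := by
  rw [hermitePoly, hermitePoly, pderiv_expNegHalfLap, pderiv_phi_add_single, expNegHalfLap_smul]

/-- If `ν i = 0` the truncated subtraction is harmless, as the factor `√(ν i)` vanishes. -/
theorem pderiv_hermitePoly (ν : Fin d →₀ ℕ) (i : Fin d) :
    pderiv i (hermitePoly ν)
      = ((Real.sqrt (ν i) : ℝ) : ℂ) • hermitePoly (ν - Finsupp.single i 1) := by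
  by_cases h : ν i = 0
  · rw [hermitePoly, pderiv_expNegHalfLap, pderiv_phi_of_eq_zero h, h]
    simpa using expNegHalfLap_smul 0 (0 : Poly d)
  · obtain ⟨μ, rfl⟩ := eq_add_single_of_ne_zero h
    rw [pderiv_hermitePoly_add_single, add_tsub_cancel_right]
    simp

theorem hermitePoly_recurrence (ν : Fin d →₀ ℕ) (i : Fin d) (z : Fin d → ℂ) :
    ((Real.sqrt (ν i + 1) : ℝ) : ℂ) * eval z (hermitePoly (ν + Finsupp.single i 1))
      = z i * eval z (hermitePoly ν)
        - ((Real.sqrt (ν i) : ℝ) : ℂ) * eval z (hermitePoly (ν - Finsupp.single i 1)) := by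
  have := congrArg (eval z) (smul_hermitePoly_add_single ν i)
  rwa [pderiv_hermitePoly, smul_eval, map_sub, map_mul, eval_X, smul_eval] at this

theorem exists_eq_add_single {ν : Fin d →₀ ℕ} {n : ℕ} (h : ν.degree = n + 1) :
    ∃ μ i, ν = μ + Finsupp.single i 1 ∧ μ.degree = n := by
  have h0 : ν ≠ 0 := by
    rintro rfl
    simp at h
  obtain ⟨i, hi⟩ := Finsupp.ne_iff.1 h0
  obtain ⟨μ, rfl⟩ := eq_add_single_of_ne_zero hi
  exact ⟨μ, i, rfl, by simpa using h⟩

theorem degree_tsub_single {ν : Fin d →₀ ℕ} {i : Fin d} (h : ν i ≠ 0) :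
    (ν - Finsupp.single i 1).degree + 1 = ν.degree := by
  obtain ⟨μ, rfl⟩ := eq_add_single_of_ne_zero h
  simp

/-- The recurrence has real coefficients. This reconciles the sesquilinear `L²` product with the
bilinear integration by parts. -/
theorem conj_eval_hermitePoly (y : E d) (ν : Fin d →₀ ℕ) :
    starRingEnd ℂ (eval (toComplex y) (hermitePoly ν)) = eval (toComplex y) (hermitePoly ν) := by
  induction hn : ν.degree using Nat.strong_induction_on generalizing ν with
  | _ n ih =>
    rcases n with _ | n
    · rw [(Finsupp.degree_eq_zero_iff ν).1 hn, hermitePoly_zero]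
      simp
    · obtain ⟨μ, i, rfl, hμ⟩ := exists_eq_add_single hn
      have hs : ((Real.sqrt (μ i + 1) : ℝ) : ℂ) ≠ 0 :=
        Complex.ofReal_ne_zero.2 (Real.sqrt_pos.2 (by positivity)).ne'
      have hrec := hermitePoly_recurrence μ i (toComplex y)
      refine mul_left_cancel₀ hs ?_
      rw [hrec]
      have := congrArg (starRingEnd ℂ) hrec
      rw [map_mul, Complex.conj_ofReal] at this
      rw [this, map_sub, map_mul, map_mul, Complex.conj_ofReal, ih n (by omega) μ hμ]
      congr 1
      · rw [toComplex, Complex.conj_ofReal]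
      · by_cases hi : μ i = 0
        · simp [hi]
        · rw [ih (n - 1) (by omega) _ (by have := degree_tsub_single hi; omega)]

/-- In the recurrence, divide by `√(μ i + 1)`, which is at least `1` and at least `√(μ i)`. The
bound is crude, but any geometric growth is absorbed by the decay of `V_k(φ_ν)`. -/
theorem norm_eval_hermitePoly_le (y : E d) (ν : Fin d →₀ ℕ) :
    ‖eval (toComplex y) (hermitePoly ν)‖ ≤ (1 + ‖y‖) ^ ν.degree := by
  induction hn : ν.degree using Nat.strong_induction_on generalizing ν with
  | _ n ih =>
    rcases n with _ | n
    · rw [(Finsupp.degree_eq_zero_iff ν).1 hn, hermitePoly_zero]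
      simp
    · obtain ⟨μ, i, rfl, hμ⟩ := exists_eq_add_single hn
      have hs : 0 < Real.sqrt (μ i + 1) := Real.sqrt_pos.2 (by positivity)
      have hs1 : 1 ≤ Real.sqrt (μ i + 1) := Real.one_le_sqrt.2 (by simp)
      have hrec := congrArg norm (hermitePoly_recurrence μ i (toComplex y))
      rw [norm_mul, Complex.norm_real, Real.norm_of_nonneg hs.le] at hrec
      refine le_of_mul_le_mul_left ?_ hs
      rw [hrec]
      have h1 : ‖toComplex y i * eval (toComplex y) (hermitePoly μ)‖
          ≤ Real.sqrt (μ i + 1) * (‖y‖ * (1 + ‖y‖) ^ n) := by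
        rw [norm_mul, toComplex, Complex.norm_real]
        calc ‖y i‖ * ‖eval (toComplex y) (hermitePoly μ)‖ ≤ ‖y‖ * (1 + ‖y‖) ^ n := by
              gcongr
              · exact PiLp.norm_apply_le y i
              · exact ih n (by omega) μ hμ
          _ ≤ _ := le_mul_of_one_le_left (by positivity) hs1
      have h2 : ‖((Real.sqrt (μ i) : ℝ) : ℂ)
          * eval (toComplex y) (hermitePoly (μ - Finsupp.single i 1))‖
          ≤ Real.sqrt (μ i + 1) * (1 + ‖y‖) ^ n := by
        by_cases hi : μ i = 0
        · rw [hi]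
          simp only [Nat.cast_zero, Real.sqrt_zero, Complex.ofReal_zero, zero_mul, norm_zero]
          positivity
        · rw [norm_mul, Complex.norm_real, Real.norm_of_nonneg (Real.sqrt_nonneg _)]
          have hdeg := degree_tsub_single hi
          have h3 := ih (n - 1) (by omega) (μ - Finsupp.single i 1) (by omega)
          have h4 : (1 + ‖y‖) ^ (n - 1) ≤ (1 + ‖y‖) ^ n :=
            pow_le_pow_right₀ (by linarith [norm_nonneg y]) (by omega)
          gcongr
          · linarith
          · exact h3.trans h4
      calc _ ≤ _ := norm_sub_le _ _
        _ ≤ _ := add_le_add h1 h2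
        _ = _ := by ring

/-! ### The expansion of `E_n(x, ·)` -/

theorem coeff_pairingPow (n : ℕ) (ν : Fin d →₀ ℕ) :
    coeff ν (pairingPow d n)
      = if ν.degree = n then monomial ν ((ν.multinomial : ℕ) : ℂ) else 0 := by
  have h : (∑ j, C (X j : Poly d) * X j : MvPolynomial (Fin d) (Poly d))
      = (Finsupp.equivFunOnFinite.symm fun j => (X j : Poly d)).linearCombination (Poly d) X := by
    rw [Finsupp.linearCombination_apply, Finsupp.sum_fintype _ _ (by simp)]
    simp [smul_eq_C_mul]
  rw [pairingPow, h, coeff_linearCombination_X_pow]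
  have h2 : (ν.sum fun _ m => m) = ν.degree := rfl
  rw [h2]
  split_ifs
  · rw [monomial_eq, map_natCast]
    rfl
  · rfl

/-- The coefficient `1 / ν!` splits evenly, one square root normalizing `φ_ν` in each variable. -/
theorem factorial_inv_smul_multinomial (ν : Fin d →₀ ℕ) :
    (ν.degree.factorial : ℂ)⁻¹ * (ν.multinomial : ℂ)
      = ((Real.sqrt (∏ i, ((ν i).factorial : ℝ)))⁻¹ : ℝ)
        * ((Real.sqrt (∏ i, ((ν i).factorial : ℝ)))⁻¹ : ℝ) := by
  have h1 := Nat.multinomial_spec (Finset.univ : Finset (Fin d)) ν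
  rw [← Finsupp.multinomial_eq_of_support_subset (Finset.subset_univ _),
    ← Finsupp.degree_eq_sum] at h1
  have h2 : (∏ i, ((ν i).factorial : ℂ)) * (ν.multinomial : ℂ) = (ν.degree.factorial : ℂ) := by
    exact_mod_cast h1
  have h3 : (∏ i, ((ν i).factorial : ℂ)) ≠ 0 := by
    exact_mod_cast (prod_factorial_pos ν).ne'
  have h4 : (ν.degree.factorial : ℂ) ≠ 0 := by exact_mod_cast Nat.factorial_ne_zero _
  rw [← Complex.ofReal_mul, ← mul_inv, Real.mul_self_sqrt (prod_factorial_pos ν).le]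
  push_cast
  rw [← h2] at h4 ⊢
  field_simp
  exact div_self (right_ne_zero_of_mul h4)

theorem dunklE_eq_sum (R : Finset (E d)) (β : E d) (k : E d → ℂ) (n : ℕ) (x : Fin d → ℂ) :
    dunklE R β k n x = ∑ ν ∈ Finset.univ.finsuppAntidiag n,
      eval x (intertwiningOp R β k (phi ν)) • phi ν := by
  have hmem : ∀ ν : Fin d →₀ ℕ, ν ∈ Finset.univ.finsuppAntidiag n ↔ ν.degree = n := fun ν => by
    simp [Finset.mem_finsuppAntidiag, Finsupp.degree_eq_sum]
  have hsub : (pairingPow d n).support ⊆ Finset.univ.finsuppAntidiag n := fun ν hν => by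
    rw [hmem]
    by_contra h
    rw [mem_support_iff, coeff_pairingPow, if_neg h] at hν
    exact hν rfl
  rw [dunklE, Finset.sum_subset hsub fun ν _ hν => by
    rw [notMem_support_iff.1 hν, map_zero, map_zero, mul_zero, monomial_zero]]
  refine Finset.sum_congr rfl fun ν hν => ?_
  rw [hmem] at hν
  subst hν
  have h : ∀ c : ℂ, monomial ν c = c • (monomial ν 1 : Poly d) := fun c => by
    rw [smul_monomial, smul_eq_mul, mul_one]
  rw [coeff_pairingPow, if_pos rfl, phi, smul_monomial]
  congr 1
  rw [h (ν.multinomial : ℂ), h ((_ : ℝ) : ℂ), LinearMap.map_smul, LinearMap.map_smul, smul_eval, smul_eval, ← mul_assoc,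
    factorial_inv_smul_multinomial, smul_eq_mul]
  ring

/-! ### Polynomials under the Gaussian measure -/

theorem continuous_eval_toComplex (p : Poly d) :
    Continuous fun y : E d => eval (toComplex y) p :=
  (MvPolynomial.continuous_eval p).comp (by unfold toComplex; fun_prop)

theorem integrable_eval_mul_exp (p : Poly d) {b : ℝ} (hb : 0 < b) :
    Integrable fun y : E d => eval (toComplex y) p * ((Real.exp (-b * ‖y‖ ^ 2) : ℝ) : ℂ) := by
  induction p using MvPolynomial.induction_on generalizing b with
  | C a =>
    have := (GaussianFourier.integrable_cexp_neg_mul_sq_norm_add (V := E d) (b := (b : ℂ))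
      (by simpa using hb) 0 0).const_mul a
    simpa using this
  | add p q hp hq =>
    simp only [map_add, add_mul]
    exact (hp hb).add (hq hb)
  | mul_X p i hp =>
    -- Half of the Gaussian absorbs the factor `y_i`; the other half serves the induction
    -- hypothesis.
    have hb2 : 0 < b / 2 := by positivity
    have hbd : ∀ y : E d, ‖toComplex y i * ((Real.exp (-(b / 2) * ‖y‖ ^ 2) : ℝ) : ℂ)‖
        ≤ 1 + 1 / (b / 2) := by
      intro y
      rw [norm_mul, toComplex, Complex.norm_real, Complex.norm_real,
        Real.norm_of_nonneg (Real.exp_pos _).le, neg_mul, Real.exp_neg, ← div_eq_mul_inv,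
        div_le_iff₀ (Real.exp_pos _)]
      have h1 := Real.add_one_le_exp (b / 2 * ‖y‖ ^ 2)
      have h2 : ‖y i‖ ≤ ‖y‖ := PiLp.norm_apply_le y i
      have h3 : ‖y‖ ≤ 1 + ‖y‖ ^ 2 := by nlinarith [sq_nonneg (‖y‖ - 1)]
      calc ‖y i‖ ≤ 1 + ‖y‖ ^ 2 := h2.trans h3
        _ ≤ 1 + ‖y‖ ^ 2 + (b / 2 * ‖y‖ ^ 2 + 1 / (b / 2)) := le_add_of_nonneg_right (by positivity)
        _ = (1 + 1 / (b / 2)) * (b / 2 * ‖y‖ ^ 2 + 1) := by field_simp; ring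
        _ ≤ _ := by gcongr
    have hc : Continuous fun y : E d =>
        toComplex y i * ((Real.exp (-(b / 2) * ‖y‖ ^ 2) : ℝ) : ℂ) := by
      unfold toComplex
      fun_prop
    refine ((hp hb2).bdd_mul hc.aestronglyMeasurable (Filter.Eventually.of_forall hbd)).congr
      (Filter.Eventually.of_forall fun y => ?_)
    have he : Real.exp (-b * ‖y‖ ^ 2)
        = Real.exp (-(b / 2) * ‖y‖ ^ 2) * Real.exp (-(b / 2) * ‖y‖ ^ 2) := by
      rw [← Real.exp_add]
      congr 1
      ring
    simp only [map_mul, eval_X, he, Complex.ofReal_mul]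
    ring

/-- The density of the Gaussian measure. -/
noncomputable def gaussDensity (y : E d) : ℝ := (c0 d)⁻¹ * Real.exp (-‖y‖ ^ 2 / 2)

theorem c0_pos (d : ℕ) : 0 < c0 d := Real.rpow_pos_of_pos (by positivity) _

theorem gaussDensity_pos (y : E d) : 0 < gaussDensity y :=
  mul_pos (inv_pos.2 (c0_pos d)) (Real.exp_pos _)

theorem continuous_gaussDensity : Continuous (gaussDensity (d := d)) := by
  unfold gaussDensity
  fun_prop

theorem measurable_toNNReal_gaussDensity :
    Measurable fun y : E d => (gaussDensity y).toNNReal :=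
  continuous_gaussDensity.measurable.real_toNNReal

theorem gauss_eq : gauss d = volume.withDensity fun y => ((gaussDensity y).toNNReal : ENNReal) :=
  rfl

variable {F : Type*} [NormedAddCommGroup F] [NormedSpace ℝ F]

theorem integrable_gauss_iff {f : E d → F} :
    Integrable f (gauss d) ↔ Integrable fun y => gaussDensity y • f y := by
  rw [gauss_eq, integrable_withDensity_iff_integrable_smul measurable_toNNReal_gaussDensity]
  simp only [NNReal.smul_def, Real.coe_toNNReal _ (gaussDensity_pos _).le]

theorem integral_gauss (f : E d → F) :
    ∫ y, f y ∂gauss d = ∫ y, gaussDensity y • f y := by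
  rw [gauss_eq, integral_withDensity_eq_integral_smul measurable_toNNReal_gaussDensity]
  simp only [NNReal.smul_def, Real.coe_toNNReal _ (gaussDensity_pos _).le]

theorem aestronglyMeasurable_gauss_iff {f : E d → F} :
    AEStronglyMeasurable f (gauss d) ↔ AEStronglyMeasurable fun y => gaussDensity y • f y := by
  rw [gauss_eq, aestronglyMeasurable_withDensity_iff measurable_toNNReal_gaussDensity]
  simp only [Real.coe_toNNReal _ (gaussDensity_pos _).le]

theorem integrable_eval_mul_gaussDensity (p : Poly d) :
    Integrable fun y : E d => eval (toComplex y) p * (gaussDensity y : ℂ) := by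
  refine ((integrable_eval_mul_exp p (one_half_pos (α := ℝ))).mul_const
    (((c0 d)⁻¹ : ℝ) : ℂ)).congr (Filter.Eventually.of_forall fun y => ?_)
  have : -(1 / 2) * ‖y‖ ^ 2 = -‖y‖ ^ 2 / 2 := by ring
  simp only [gaussDensity, this, Complex.ofReal_mul]
  ring

theorem integrable_eval_gauss (p : Poly d) :
    Integrable (fun y : E d => eval (toComplex y) p) (gauss d) := by
  rw [integrable_gauss_iff]
  simpa only [Complex.real_smul, mul_comm] using integrable_eval_mul_gaussDensity p

theorem integral_gauss_one : ∫ _ : E d, (1 : ℂ) ∂gauss d = 1 := by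
  rw [integral_gauss]
  have h : ∀ y : E d, gaussDensity y • (1 : ℂ)
      = (((c0 d)⁻¹ * Real.exp (-(1 / 2) * ‖y‖ ^ 2) : ℝ) : ℂ) := fun y => by
    rw [Complex.real_smul, mul_one, gaussDensity]
    congr 3
    ring
  simp only [h]
  rw [integral_complex_ofReal, integral_const_mul,
    GaussianFourier.integral_rexp_neg_mul_sq_norm one_half_pos, finrank_euclideanSpace_fin]
  have : Real.pi / (1 / 2) = 2 * Real.pi := by ring
  rw [this, ← c0, inv_mul_cancel₀ (c0_pos d).ne', Complex.ofReal_one]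

theorem hasLineDerivAt_eval (p : Poly d) (i : Fin d) (y : E d) :
    HasLineDerivAt ℝ (fun y : E d => eval (toComplex y) p)
      (eval (toComplex y) (pderiv i p)) y (EuclideanSpace.single i 1) := by
  induction p using MvPolynomial.induction_on with
  | C a => simpa [HasLineDerivAt] using hasDerivAt_const (0 : ℝ) a
  | add p q hp hq =>
    simp only [map_add]
    exact HasDerivAt.add hp hq
  | mul_X p j hp =>
    have hX : HasDerivAt (fun t : ℝ => toComplex (y + t • EuclideanSpace.single i 1) j)
        (if j = i then 1 else 0) 0 := by
      by_cases h : j = i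
      · subst h
        have := ((hasDerivAt_id (0 : ℝ)).const_add (y j)).ofReal_comp
        simpa [toComplex] using this
      · simpa [toComplex, h] using hasDerivAt_const (0 : ℝ) ((y j : ℝ) : ℂ)
    have := HasDerivAt.mul (show HasDerivAt _ _ _ from hp) hX
    simp only [HasLineDerivAt, map_mul, eval_X, Derivation.leibniz, map_add, smul_eq_mul]
    convert! this using 1
    by_cases h : j = i
    · subst h
      simp [add_comm, mul_comm]
    · simp [h, pderiv_X_of_ne h, mul_comm]

theorem hasLineDerivAt_gaussDensity (i : Fin d) (y : E d) :
    HasLineDerivAt ℝ (fun y : E d => (gaussDensity y : ℂ))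
      (-(toComplex y i * (gaussDensity y : ℂ))) y (EuclideanSpace.single i 1) := by
  have h0 : HasDerivAt (fun t : ℝ => y + t • EuclideanSpace.single i (1 : ℝ))
      (EuclideanSpace.single i 1) 0 := by
    simpa using ((hasDerivAt_id (0 : ℝ)).smul_const (EuclideanSpace.single i (1 : ℝ))).const_add y
  have h1 := ((h0.norm_sq.neg.div_const 2).exp.const_mul (c0 d)⁻¹).ofReal_comp
  unfold HasLineDerivAt
  convert! h1 using 1
  simp [gaussDensity, toComplex, EuclideanSpace.inner_single_right]
  ring

/-- Gaussian integration by parts. -/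
theorem integral_X_mul (p : Poly d) (i : Fin d) :
    ∫ y, eval (toComplex y) (X i * p) ∂gauss d
      = ∫ y, eval (toComplex y) (pderiv i p) ∂gauss d := by
  have h := integral_bilinear_hasLineDerivAt_right_eq_neg_left_of_integrable
    (μ := (volume : Measure (E d))) (B := ContinuousLinearMap.mul ℝ ℂ)
    (f := fun y : E d => eval (toComplex y) p) (g := fun y : E d => (gaussDensity y : ℂ))
    (f' := fun y : E d => eval (toComplex y) (pderiv i p))
    (g' := fun y : E d => -(toComplex y i * (gaussDensity y : ℂ)))
    (integrable_eval_mul_gaussDensity _)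
    (by
      refine (integrable_eval_mul_gaussDensity (X i * p)).neg.congr
        (Filter.Eventually.of_forall fun y => ?_)
      simp only [Pi.neg_apply, map_mul, eval_X, ContinuousLinearMap.mul_apply']
      ring)
    (integrable_eval_mul_gaussDensity _)
    (fun y _ => hasLineDerivAt_eval p i y) (fun y _ => hasLineDerivAt_gaussDensity i y)
  rw [integral_gauss, integral_gauss]
  simp only [ContinuousLinearMap.mul_apply', mul_neg, integral_neg, neg_inj] at h
  calc _ = ∫ y : E d, eval (toComplex y) p * (toComplex y i * (gaussDensity y : ℂ)) := by
        refine integral_congr_ae (Filter.Eventually.of_forall fun y => ?_)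
        simp only [Complex.real_smul, map_mul, eval_X]
        ring
    _ = _ := h
    _ = _ := by
        simp only [Complex.real_smul, mul_comm]

/-- `x_i - ∂_i` is the transpose of `∂_i` for the bilinear Gaussian pairing. -/
theorem integral_X_mul_sub_pderiv_mul (p q : Poly d) (i : Fin d) :
    ∫ y, eval (toComplex y) ((X i * p - pderiv i p) * q) ∂gauss d
      = ∫ y, eval (toComplex y) (p * pderiv i q) ∂gauss d := by
  have h := integral_X_mul (p * q) i
  have e1 : (X i * p - pderiv i p) * q = X i * (p * q) - pderiv i p * q := by ring
  have e2 : pderiv i (p * q) = p * pderiv i q + pderiv i p * q := by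
    rw [Derivation.leibniz, smul_eq_mul, smul_eq_mul]; ring
  rw [e2] at h
  simp only [map_add] at h
  rw [integral_add (integrable_eval_gauss _) (integrable_eval_gauss _)] at h
  rw [e1]
  simp only [map_sub]
  rw [integral_sub (integrable_eval_gauss _) (integrable_eval_gauss _), h, add_sub_cancel_right]

theorem sqrt_mul_integral_hermitePoly_add_single (κ μ : Fin d →₀ ℕ) (i : Fin d) :
    ((Real.sqrt (κ i + 1) : ℝ) : ℂ) *
        ∫ y, eval (toComplex y) (hermitePoly (κ + Finsupp.single i 1) * hermitePoly μ) ∂gauss d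
      = ((Real.sqrt (μ i) : ℝ) : ℂ) *
        ∫ y, eval (toComplex y) (hermitePoly κ * hermitePoly (μ - Finsupp.single i 1)) ∂gauss d := by
  have h := integral_X_mul_sub_pderiv_mul (hermitePoly κ) (hermitePoly μ) i
  rw [← smul_hermitePoly_add_single, pderiv_hermitePoly, smul_mul_assoc, mul_smul_comm] at h
  simpa only [smul_eval, integral_const_mul] using h

theorem integral_hermitePoly_mul (ν μ : Fin d →₀ ℕ) :
    ∫ y, eval (toComplex y) (hermitePoly ν * hermitePoly μ) ∂gauss d = if ν = μ then 1 else 0 := by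
  have hs : ∀ n : ℕ, ((Real.sqrt (n + 1) : ℝ) : ℂ) ≠ 0 := fun n =>
    Complex.ofReal_ne_zero.2 (Real.sqrt_pos.2 (by positivity)).ne'
  induction hn : ν.degree generalizing ν μ with
  | zero =>
    rw [Finsupp.degree_eq_zero_iff] at hn
    subst hn
    by_cases hμ : 0 = μ
    · subst hμ
      simpa [hermitePoly_zero] using integral_gauss_one
    · obtain ⟨i, hi⟩ := Finsupp.ne_iff.1 (Ne.symm hμ)
      obtain ⟨κ, rfl⟩ := eq_add_single_of_ne_zero hi
      -- After the swap the lowering falls on `H_0`, where its factor `√0` kills the integral.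
      rw [if_neg hμ, mul_comm]
      refine mul_left_cancel₀ (hs (κ i)) ?_
      rw [sqrt_mul_integral_hermitePoly_add_single]
      simp
  | succ n ih =>
    obtain ⟨κ, i, rfl, hκ⟩ := exists_eq_add_single hn
    refine mul_left_cancel₀ (hs (κ i)) ?_
    rw [sqrt_mul_integral_hermitePoly_add_single, ih _ _ hκ]
    by_cases hi : μ i = 0
    · have hne : κ + Finsupp.single i 1 ≠ μ := by
        rintro rfl
        simp at hi
      simp [hi, hne]
    · obtain ⟨μ, rfl⟩ := eq_add_single_of_ne_zero hi
      rw [add_tsub_cancel_right]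
      by_cases h : κ = μ
      · subst h
        simp
      · simp [h]

theorem memLp_hermitePoly (ν : Fin d →₀ ℕ) :
    MemLp (fun y : E d => eval (toComplex y) (hermitePoly ν)) 2 (gauss d) := by
  rw [memLp_two_iff_integrable_sq_norm (continuous_eval_toComplex _).aestronglyMeasurable]
  refine (integrable_eval_gauss (hermitePoly ν * hermitePoly ν)).norm.congr
    (Filter.Eventually.of_forall fun y => ?_)
  simp only [map_mul, norm_mul, sq]

theorem orthonormal_hermitePoly :
    Orthonormal ℂ fun ν : Fin d →₀ ℕ => (memLp_hermitePoly ν).toLp := by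
  rw [orthonormal_iff_ite]
  intro ν μ
  rw [L2.inner_def, ← integral_hermitePoly_mul]
  refine integral_congr_ae ?_
  filter_upwards [(memLp_hermitePoly ν).coeFn_toLp, (memLp_hermitePoly μ).coeFn_toLp] with y h1 h2
  rw [h1, h2, RCLike.inner_apply, conj_eval_hermitePoly, map_mul, mul_comm]

/-! ### Summation over multi-indices -/

/-- Any finite set of multi-indices lies in a cube, over which the sum factors into `d` partial
geometric sums. -/
theorem summable_pow_degree {q : ℝ} (hq : 0 ≤ q) (hq1 : q < 1) :
    Summable fun ν : Fin d →₀ ℕ => q ^ ν.degree := by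
  classical
  refine summable_of_sum_le (c := ∏ _i : Fin d, (1 - q)⁻¹) (fun ν => by positivity) fun u => ?_
  set N := ∑ ν ∈ u, ν.degree
  calc ∑ ν ∈ u, q ^ ν.degree = ∑ f ∈ u.image (DFunLike.coe : (Fin d →₀ ℕ) → Fin d → ℕ),
        ∏ i, q ^ f i := by
        rw [Finset.sum_image DFunLike.coe_injective.injOn]
        exact Finset.sum_congr rfl fun ν _ => by
          rw [Finset.prod_pow_eq_pow_sum, Finsupp.degree_eq_sum]
    _ ≤ ∑ f ∈ Fintype.piFinset fun _ : Fin d => Finset.range (N + 1), ∏ i, q ^ f i := by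
        refine Finset.sum_le_sum_of_subset_of_nonneg ?_ fun f _ _ =>
          Finset.prod_nonneg fun _ _ => by positivity
        intro f hf
        obtain ⟨ν, hν, rfl⟩ := Finset.mem_image.1 hf
        rw [Fintype.mem_piFinset]
        intro i
        rw [Finset.mem_range, Nat.lt_succ_iff]
        exact (Finsupp.le_degree i ν).trans
          (Finset.single_le_sum (f := fun ν : Fin d →₀ ℕ => ν.degree)
            (fun _ _ => Nat.zero_le _) hν)
    _ = ∏ _i : Fin d, ∑ n ∈ Finset.range (N + 1), q ^ n := (Finset.prod_univ_sum _ _).symm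
    _ ≤ ∏ _i : Fin d, (1 - q)⁻¹ := by
        refine Finset.prod_le_prod (fun _ _ => Finset.sum_nonneg fun _ _ => by positivity)
          fun _ _ => ?_
        rw [← tsum_geometric_of_lt_one hq hq1]
        exact (summable_geometric_of_lt_one hq hq1).sum_le_tsum _ fun _ _ => by positivity

theorem summable_norm_intertwiningOp_phi (R : Finset (E d)) (β : E d) (k : E d → ℂ)
    (x : Fin d → ℂ) :
    Summable fun ν : Fin d →₀ ℕ => ‖eval x (intertwiningOp R β k (phi ν))‖ := by
  obtain ⟨M, _, hM⟩ := exists_norm_intertwiningOp_phi_le R β k x (one_half_pos (α := ℝ))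
  exact Summable.of_nonneg_of_le (fun _ => norm_nonneg _) hM
    ((summable_pow_degree (by norm_num) (by norm_num)).mul_left M)

theorem summable_sq_norm_intertwiningOp_phi (R : Finset (E d)) (β : E d) (k : E d → ℂ)
    (x : Fin d → ℂ) :
    Summable fun ν : Fin d →₀ ℕ => ‖eval x (intertwiningOp R β k (phi ν))‖ ^ 2 := by
  obtain ⟨M, _, hM⟩ := exists_norm_intertwiningOp_phi_le R β k x (one_half_pos (α := ℝ))
  refine Summable.of_nonneg_of_le (fun _ => by positivity) (fun ν => ?_)
    ((summable_norm_intertwiningOp_phi R β k x).mul_left M)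
  rw [sq]
  gcongr
  refine (hM ν).trans (mul_le_of_le_one_right ‹_› (pow_le_one₀ (by norm_num) (by norm_num)))

theorem summable_kernelL (R : Finset (E d)) (β : E d) (k : E d → ℂ) (x : Fin d → ℂ) (y : E d) :
    Summable fun ν : Fin d →₀ ℕ =>
      eval x (intertwiningOp R β k (phi ν)) * eval (toComplex y) (hermitePoly ν) := by
  have hy : 0 < 1 + ‖y‖ := by positivity
  -- This `ε` satisfies `ε (1 + ‖y‖) = 1/2`.
  obtain ⟨M, hM0, hM⟩ := exists_norm_intertwiningOp_phi_le R β k x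
    (ε := (1 / 2) / (1 + ‖y‖)) (by positivity)
  refine Summable.of_norm_bounded
    ((summable_pow_degree (q := 1 / 2) (by norm_num) (by norm_num)).mul_left M) fun ν => ?_
  calc _ = ‖eval x (intertwiningOp R β k (phi ν))‖ * ‖eval (toComplex y) (hermitePoly ν)‖ :=
        norm_mul _ _
    _ ≤ M * ((1 / 2) / (1 + ‖y‖)) ^ ν.degree * (1 + ‖y‖) ^ ν.degree := by
        gcongr
        · exact hM ν
        · exact norm_eval_hermitePoly_le y ν
    _ = _ := by rw [mul_assoc, ← mul_pow, div_mul_cancel₀ _ hy.ne']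

/-- The pointwise expansion of `L_k(x, ·)` in Hermite polynomials. -/
theorem hasSum_kernelL (R : Finset (E d)) (β : E d) (k : E d → ℂ) (x : Fin d → ℂ) (y : E d) :
    HasSum (fun ν : Fin d →₀ ℕ =>
      eval x (intertwiningOp R β k (phi ν)) * eval (toComplex y) (hermitePoly ν))
      (kernelL R β k x y) := by
  have hs := summable_kernelL R β k x y
  convert hs.hasSum using 1
  -- Absolute convergence allows grouping by degree, which matches the series defining `kernelL`.
  rw [← (Equiv.sigmaFiberEquiv fun ν : Fin d →₀ ℕ => ν.degree).tsum_eq]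
  refine Eq.trans ?_
    ((Equiv.sigmaFiberEquiv fun ν : Fin d →₀ ℕ => ν.degree).summable_iff.2 hs).tsum_sigma.symm
  refine tsum_congr fun n => ?_
  rw [dunklE_eq_sum, expNegHalfLap_sum, map_sum]
  simp only [smul_eval, Function.comp_apply, Equiv.sigmaFiberEquiv_apply]
  rw [← Finset.tsum_subtype]
  refine (Equiv.subtypeEquivRight fun ν => ?_).tsum_eq
    (fun ν : {ν : Fin d →₀ ℕ // ν.degree = n} =>
      eval x (intertwiningOp R β k (phi ν)) * eval (toComplex y) (hermitePoly ν))
  simp [Finset.mem_finsuppAntidiag, Finsupp.degree_eq_sum]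

/-! ### The kernel `L_k` in `L²` -/

theorem summable_hermite_toLp (R : Finset (E d)) (β : E d) (k : E d → ℂ) (x : Fin d → ℂ) :
    Summable fun ν : Fin d →₀ ℕ =>
      ‖eval x (intertwiningOp R β k (phi ν)) • (memLp_hermitePoly ν).toLp‖ := by
  simpa only [norm_smul, orthonormal_hermitePoly.1, mul_one] using
    summable_norm_intertwiningOp_phi R β k x

/-- An absolutely convergent series in `L²` also converges almost everywhere to its sum, so the
pointwise expansion identifies the limit. Only countably many null sets arise from the
representatives. -/
theorem tsum_hermite_toLp_ae_eq (R : Finset (E d)) (β : E d) (k : E d → ℂ) (x : Fin d → ℂ) :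
    ⇑(∑' ν : Fin d →₀ ℕ, eval x (intertwiningOp R β k (phi ν)) • (memLp_hermitePoly ν).toLp)
      =ᵐ[gauss d] kernelL R β k x := by
  have hs := summable_hermite_toLp R β k x
  have h1 := Lp.hasSum_coeFn_tsum (tsum_enorm_ne_top_iff_summable_norm.2 hs)
  have h2 : ∀ᵐ y ∂gauss d, ∀ ν : Fin d →₀ ℕ,
      (eval x (intertwiningOp R β k (phi ν)) • (memLp_hermitePoly ν).toLp) y
        = eval x (intertwiningOp R β k (phi ν)) * eval (toComplex y) (hermitePoly ν) := by
    refine ae_all_iff.2 fun ν => ?_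
    filter_upwards [Lp.coeFn_smul (eval x (intertwiningOp R β k (phi ν)))
      (memLp_hermitePoly ν).toLp, (memLp_hermitePoly ν).coeFn_toLp] with y h3 h4
    rw [h3, Pi.smul_apply, h4, smul_eq_mul]
  filter_upwards [h1, h2] with y hy1 hy2
  simp only [hy2] at hy1
  exact hy1.unique (hasSum_kernelL R β k x y)

theorem memLp_kernelL (R : Finset (E d)) (β : E d) (k : E d → ℂ) (x : Fin d → ℂ) :
    MemLp (kernelL R β k x) 2 (gauss d) :=
  (memLp_congr_ae (tsum_hermite_toLp_ae_eq R β k x)).1 (Lp.memLp _)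

/-- The expansion of `L_k(x, ·)` in Hermite polynomials, in `L²(γ)`. -/
theorem hasSum_toLp_kernelL (R : Finset (E d)) (β : E d) (k : E d → ℂ) (x : Fin d → ℂ) :
    HasSum (fun ν : Fin d →₀ ℕ =>
      eval x (intertwiningOp R β k (phi ν)) • (memLp_hermitePoly ν).toLp)
      (memLp_kernelL R β k x).toLp := by
  convert (summable_hermite_toLp R β k x).of_norm.hasSum using 1
  refine Lp.ext ?_
  exact (memLp_kernelL R β k x).coeFn_toLp.trans (tsum_hermite_toLp_ae_eq R β k x).symm

/-- Pythagoras on finite sums and continuity of the norm; completeness of the family plays no role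
since `f` is already the sum. -/
theorem _root_.Orthonormal.norm_sq_eq_tsum {𝕜 H ι : Type*} [RCLike 𝕜] [NormedAddCommGroup H]
    [InnerProductSpace 𝕜 H] {e : ι → H} (he : Orthonormal 𝕜 e) {a : ι → 𝕜} {f : H}
    (hf : HasSum (fun i => a i • e i) f) : ‖f‖ ^ 2 = ∑' i, ‖a i‖ ^ 2 := by
  have hsum : ∀ s : Finset ι, ‖∑ i ∈ s, a i • e i‖ ^ 2 = ∑ i ∈ s, ‖a i‖ ^ 2 := by
    intro s
    have h := he.inner_sum a a s
    rw [inner_self_eq_norm_sq_to_K] at h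
    simp only [RCLike.conj_mul] at h
    exact_mod_cast h
  have h : HasSum (fun i => ‖a i‖ ^ 2) (‖f‖ ^ 2) := by
    have h1 : Filter.Tendsto (fun s : Finset ι => ‖∑ i ∈ s, a i • e i‖ ^ 2) Filter.atTop
        (nhds (‖f‖ ^ 2)) := (Filter.Tendsto.norm hf).pow 2
    simp only [hsum] at h1
    exact h1
  exact h.tsum_eq.symm

theorem sq_norm_toLp {f : E d → ℂ} (hf : MemLp f 2 (gauss d)) :
    ((‖hf.toLp‖ ^ 2 : ℝ)) = ∫ y, ‖f y‖ ^ 2 ∂gauss d := by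
  have h : ((‖hf.toLp‖ ^ 2 : ℝ) : ℂ) = ((∫ y, ‖f y‖ ^ 2 ∂gauss d : ℝ) : ℂ) := by
    have h1 := inner_self_eq_norm_sq_to_K (𝕜 := ℂ) hf.toLp
    rw [L2.inner_def] at h1
    push_cast
    refine h1.symm.trans ?_
    rw [← integral_complex_ofReal]
    refine integral_congr_ae ?_
    filter_upwards [hf.coeFn_toLp] with y hy
    rw [hy, inner_self_eq_norm_sq_to_K]
    simp
  exact_mod_cast h

theorem sq_norm_exp_mul (y : E d) (z : ℂ) :
    ‖((Real.exp (-‖y‖ ^ 2 / 4) : ℝ) : ℂ) * z‖ ^ 2 = c0 d * (gaussDensity y • ‖z‖ ^ 2) := by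
  have h : Real.exp (-‖y‖ ^ 2 / 4) ^ 2 = Real.exp (-‖y‖ ^ 2 / 2) := by
    rw [← Real.exp_nat_mul]
    congr 1
    push_cast
    ring
  rw [norm_mul, Complex.norm_real, Real.norm_of_nonneg (Real.exp_pos _).le, mul_pow, h,
    gaussDensity, smul_eq_mul, mul_assoc, mul_inv_cancel_left₀ (c0_pos d).ne']

theorem memLp_exp_mul {f : E d → ℂ} (hf : MemLp f 2 (gauss d)) :
    MemLp (fun y : E d => ((Real.exp (-‖y‖ ^ 2 / 4) : ℝ) : ℂ) * f y) 2 := by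
  have hm : AEStronglyMeasurable (fun y : E d => ((Real.exp (-‖y‖ ^ 2 / 4) : ℝ) : ℂ) * f y) := by
    -- Measurability for `γ` is that of density times `f`; this continuous factor turns the density
    -- into `e^{-‖y‖²/4}`.
    have hc : Continuous fun y : E d => c0 d * Real.exp (‖y‖ ^ 2 / 4) := by fun_prop
    refine (hc.aestronglyMeasurable.smul
      (aestronglyMeasurable_gauss_iff.1 hf.aestronglyMeasurable)).congr
      (Filter.Eventually.of_forall fun y => ?_)
    have h : Real.exp (-‖y‖ ^ 2 / 4) = Real.exp (‖y‖ ^ 2 / 4) * Real.exp (-‖y‖ ^ 2 / 2) := by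
      rw [← Real.exp_add]
      congr 1
      ring
    have hc0 : (c0 d : ℂ) ≠ 0 := Complex.ofReal_ne_zero.2 (c0_pos d).ne'
    simp only [Pi.smul_apply', Complex.real_smul, gaussDensity, h, Complex.ofReal_mul,
      Complex.ofReal_inv]
    field_simp
  rw [memLp_two_iff_integrable_sq_norm hm]
  simp only [sq_norm_exp_mul]
  refine Integrable.const_mul ?_ _
  rw [← integrable_gauss_iff]
  exact (memLp_two_iff_integrable_sq_norm hf.aestronglyMeasurable).1 hf

theorem integral_sq_norm_exp_mul {f : E d → ℂ} (hf : MemLp f 2 (gauss d)) :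
    ∫ y : E d, ‖((Real.exp (-‖y‖ ^ 2 / 4) : ℝ) : ℂ) * f y‖ ^ 2 = c0 d * ‖hf.toLp‖ ^ 2 := by
  simp only [sq_norm_exp_mul]
  rw [integral_const_mul, ← integral_gauss, sq_norm_toLp]

end Dunkl

theorem mainTheorem5 {d : ℕ} (R : Finset (Dunkl.E d)) (hR : Dunkl.IsRootSystem R)
    (β : Dunkl.E d) (hβ : ∀ α ∈ R, inner ℝ α β ≠ 0)
    (k : Dunkl.E d → ℂ) (hk : Dunkl.IsParameter R k) (hkM : Dunkl.MemMStar R β k)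
    (x : Fin d → ℂ) :
    -- the expansion, pointwise on `ℝ^d`
    (∀ y : Dunkl.E d,
      HasSum (fun ν : Fin d →₀ ℕ =>
        MvPolynomial.eval x (Dunkl.intertwiningOp R β k (Dunkl.phi ν)) *
          MvPolynomial.eval (Dunkl.toComplex y) (Dunkl.hermitePoly ν))
        (Dunkl.kernelL R β k x y)) ∧
    -- the expansion, in `L²(ℝ^d, dγ)`
    (∃ (hL : MeasureTheory.MemLp (Dunkl.kernelL R β k x) 2 (Dunkl.gauss d))
      (hH : ∀ ν : Fin d →₀ ℕ, MeasureTheory.MemLp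
        (fun y : Dunkl.E d => MvPolynomial.eval (Dunkl.toComplex y) (Dunkl.hermitePoly ν))
        2 (Dunkl.gauss d)),
      HasSum (fun ν : Fin d →₀ ℕ =>
        MvPolynomial.eval x (Dunkl.intertwiningOp R β k (Dunkl.phi ν)) • (hH ν).toLp)
        hL.toLp) ∧
    -- the norm identity
    (MeasureTheory.MemLp
        (fun y : Dunkl.E d => (Real.exp (-‖y‖ ^ 2 / 4) : ℂ) * Dunkl.kernelL R β k x y)
        2 MeasureTheory.volume ∧
      Summable (fun ν : Fin d →₀ ℕ =>
        ‖MvPolynomial.eval x (Dunkl.intertwiningOp R β k (Dunkl.phi ν))‖ ^ 2) ∧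
      ∫ y : Dunkl.E d, ‖(Real.exp (-‖y‖ ^ 2 / 4) : ℂ) * Dunkl.kernelL R β k x y‖ ^ 2 =
        Dunkl.c0 d * ∑' ν : Fin d →₀ ℕ,
          ‖MvPolynomial.eval x (Dunkl.intertwiningOp R β k (Dunkl.phi ν))‖ ^ 2) := by
  refine ⟨Dunkl.hasSum_kernelL R β k x, ⟨Dunkl.memLp_kernelL R β k x, Dunkl.memLp_hermitePoly,
    Dunkl.hasSum_toLp_kernelL R β k x⟩, Dunkl.memLp_exp_mul (Dunkl.memLp_kernelL R β k x),
    Dunkl.summable_sq_norm_intertwiningOp_phi R β k x, ?_⟩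
  rw [Dunkl.integral_sq_norm_exp_mul (Dunkl.memLp_kernelL R β k x),
    Dunkl.orthonormal_hermitePoly.norm_sq_eq_tsum (Dunkl.hasSum_toLp_kernelL R β k x)]
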